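/- (Count of small singular values.) For $A\in\mathcal M_n(\mathbb C)$ let $s_1(A)\ge\cdots\ge s_n(A)\ge 0$ be its singular values, i.e. the eigenvalues of $\sqrt{AA^*}$ in decreasing order with multiplicity. There exist constants $c_0>0$ and $0<\gamma<1$ such that the following holds. Let $(X_{jk})_{j,k\ge 1}$ be an infinite table of i.i.d. square integrable complex random variables, defined on one probability space, with variance $\mathbb E|X_{11}|^2-|\mathbb E X_{11}|^2=1$, and for $n\ge1$ let $X=X^{(n)}=(X_{jk})_{1\le j,k\le n}$. Let $(M_n)_{n\ge1}$ be any deterministic sequence with $M_n\in\mathcal M_n(\mathbb C)$. Then almost surely there is a (random) $n_0$ such that for all $n\ge n_0$ and all integers $i$ with $n^{1-\gamma}\le i\le n-1$, $$s_{n-i}\bigl(n^{-1/2}X+M_n\bigr)\ \ge\ c_0\,\frac{i}{n}.$$ -/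

import Mathlib

open MeasureTheory ProbabilityTheory Filter

noncomputable section

/-- The variance `E(|Z|²) - |E(Z)|²` of a complex random variable `Z`. It is only meant for square
integrable `Z`. -/
def complexVariance {Ω : Type*} [MeasurableSpace Ω] (Z : Ω → ℂ) (P : Measure Ω) : ℝ :=
  (∫ ω, ‖Z ω‖ ^ 2 ∂P) - ‖∫ ω, Z ω ∂P‖ ^ 2

/-- The singular values `s₁(A) ≥ ⋯ ≥ sₙ(A)` of a square complex matrix, with the usual numbering
`1 ≤ k ≤ n`, in decreasing order and with multiplicity. Mathlib's sequence of singular values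
starts with the index `0`, hence the shift. -/
def singularValue {n : ℕ} (A : Matrix (Fin n) (Fin n) ℂ) (k : ℕ) : ℝ :=
  (Matrix.toEuclideanLin A).singularValues (k - 1)

/-- The `n × n` upper left corner of an infinite random table, at the outcome `ω`. -/
def cornerMatrix {Ω : Type*} (X : ℕ → ℕ → Ω → ℂ) (n : ℕ) (ω : Ω) : Matrix (Fin n) (Fin n) ℂ :=
  Matrix.of fun j k => X j k ω

/-- An infinite table of independent identically distributed complex random variables which are
square integrable and have variance `1`. -/
structure IsIIDTable {Ω : Type*} [MeasurableSpace Ω] (X : ℕ → ℕ → Ω → ℂ) (P : Measure Ω) :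
    Prop where
  measurable : ∀ j k, Measurable (X j k)
  indep : iIndepFun (fun p : ℕ × ℕ => X p.1 p.2) P
  ident : ∀ j k, IdentDistrib (X j k) (X 0 0) P P
  sq_integrable : MemLp (X 0 0) 2 P
  variance_one : complexVariance (X 0 0) P = 1

end

/-! Let A be the matrix in question. Among the vectors orthogonal to its top n-i-1 right singular
vectors, those that also vanish on the last ⌊(i+1)/2⌋ coordinates form a space U of dimension at
least i/2. By the trace of its projection, some coordinate vector b_j projects to x in U with ‖x‖² ≥
i/(2n). Since x_j = ‖x‖², the estimate ‖Ax‖ ≤ s_{n-i}‖x‖ bounds s_{n-i} below by √(i/(2n)) times the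
distance of column j to the span of the other retained columns
(`exists_sqrt_mul_norm_col_sub_le_singularValue`). That span has codimension at least i/2 and is
independent of column j.

It remains to see that such a distance is at least of order √(i/n), with failure probability n⁻⁴
(`eventually_measureReal_exists_mem_submodule_le`). Gaussian linearisation turns the Laplace
transform of a squared distance into a Gaussian average of products of characteristic functions
(`integral_pi_exp_neg_norm_sq_le`). Finite variance alone gives Gaussian decay of the characteristic
function near 0 (`exists_norm_charFun_le`), so no higher moment or truncation of the entries is
needed. A union bound over i and j, then Borel–Cantelli, finishes the proof. -/

/-! ### Gaussian integrals and tails. -/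

section Gaussian

open scoped RealInnerProductSpace

theorem integral_exp_neg_mul_sq_gaussianReal_le {a : ℝ} (ha : 0 ≤ a) (ha1 : a ≤ 1) :
    ∫ x, Real.exp (-a * x ^ 2) ∂(gaussianReal 0 1) ≤ Real.exp (-a / 2) := by
  rw [integral_gaussianReal_eq_integral_smul (by norm_num)]
  have h1 : ∀ x : ℝ, gaussianPDFReal 0 1 x • Real.exp (-a * x ^ 2) =
      (√(2 * Real.pi))⁻¹ * Real.exp (-(a + 1 / 2) * x ^ 2) := by
    intro x
    simp only [gaussianPDFReal, smul_eq_mul, NNReal.coe_one, mul_one, sub_zero, mul_assoc,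
      ← Real.exp_add]
    ring_nf
  simp_rw [h1]
  rw [integral_const_mul, integral_gaussian, ← Real.sqrt_inv, ← Real.sqrt_mul (by positivity)]
  have h2 : (2 * Real.pi)⁻¹ * (Real.pi / (a + 1 / 2)) = (1 + 2 * a)⁻¹ := by
    have := Real.pi_pos
    field_simp
    ring
  have h3 : Real.exp (-a / 2) = √(Real.exp (-a)) := by
    rw [Real.exp_half]
  rw [h2, h3, Real.exp_neg]
  gcongr
  -- The integral equals (1 + 2a)^(-1/2), so the claim is exp a ≤ 1 + 2a, which follows from exp a ≤
  -- 1 + a + a² on [0, 1].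
  have := Real.abs_exp_sub_one_sub_id_le (x := a) (by rw [abs_le]; constructor <;> linarith)
  rw [abs_le] at this
  nlinarith

variable {F : Type*} [NormedAddCommGroup F] [InnerProductSpace ℝ F] [FiniteDimensional ℝ F]
  [MeasurableSpace F] [BorelSpace F]

/-- Diagonalising the quadratic form makes the integral a product over its eigenvalues. These are at
most C, so the one-dimensional bound applies to each, and their sum is the trace ∑ ‖f j‖². -/
theorem integral_exp_neg_sum_sq_inner_stdGaussian_le {ι : Type*} [Fintype ι] (f : ι → F)
    {C s : ℝ} (hC : ∀ g, ∑ j, ⟪f j, g⟫ ^ 2 ≤ C * ‖g‖ ^ 2) (hs : 0 ≤ s) (hsC : s * C ≤ 1) :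
    ∫ g, Real.exp (-s * ∑ j, ⟪f j, g⟫ ^ 2) ∂(stdGaussian F) ≤
      Real.exp (-s * (∑ j, ‖f j‖ ^ 2) / 2) := by
  let B : F →ₗ[ℝ] F := ∑ j, (innerₛₗ ℝ (f j)).smulRight (f j)
  have hBapp : ∀ x, B x = ∑ j, ⟪f j, x⟫ • f j := by intro x; simp [B]
  have hBinner : ∀ x y, ⟪B x, y⟫ = ∑ j, ⟪f j, x⟫ * ⟪f j, y⟫ := by
    intro x y; simp [hBapp, sum_inner, real_inner_smul_left]
  have hB : B.IsSymmetric := by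
    intro x y
    rw [hBinner, real_inner_comm, hBinner]
    simp_rw [mul_comm]
  set d := Module.finrank ℝ F with hd
  let b := hB.eigenvectorBasis rfl
  let μ := hB.eigenvalues rfl
  have hBb : ∀ i, B (b i) = μ i • b i := fun i => hB.apply_eigenvectorBasis rfl i
  have hμ : ∀ i, μ i = ∑ j, ⟪f j, b i⟫ ^ 2 := by
    intro i
    have := hBinner (b i) (b i)
    rw [hBb, real_inner_smul_left, real_inner_self_eq_norm_sq, b.norm_eq_one] at this
    simpa [sq] using this
  have hμ0 : ∀ i, 0 ≤ μ i := fun i => by rw [hμ]; positivity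
  have hμC : ∀ i, μ i ≤ C := fun i => by
    have := hC (b i)
    rw [b.norm_eq_one] at this
    rw [hμ]; linarith
  have htr : ∑ i, μ i = ∑ j, ‖f j‖ ^ 2 := by
    simp_rw [hμ]
    rw [Finset.sum_comm]
    exact Finset.sum_congr rfl fun j _ => b.sum_sq_inner_left (f j)
  have hquad : ∀ x : Fin d → ℝ, ∑ j, ⟪f j, ∑ i, x i • b i⟫ ^ 2 = ∑ i, μ i * x i ^ 2 := by
    intro x
    have h1 := hBinner (∑ i, x i • b i) (∑ i, x i • b i)
    simp_rw [← sq] at h1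
    rw [← h1, map_sum]
    simp_rw [map_smul, hBb]
    have h2 : ∑ i, x i • μ i • b i = ∑ i, (x i * μ i) • b i := by simp_rw [smul_smul]
    rw [h2]
    have := b.orthonormal.inner_sum (fun i => x i * μ i) x Finset.univ
    simp only [conj_trivial] at this
    rw [this]
    exact Finset.sum_congr rfl fun i _ => by ring
  rw [stdGaussian_eq_map_pi_orthonormalBasis b, integral_map (Measurable.aemeasurable (by fun_prop))
    (Measurable.aestronglyMeasurable (by fun_prop))]
  have hprod : ∀ x : Fin d → ℝ, Real.exp (-s * ∑ j, ⟪f j, ∑ i, x i • b i⟫ ^ 2) =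
      ∏ i, Real.exp (-s * μ i * x i ^ 2) := by
    intro x
    rw [hquad, Finset.mul_sum, Real.exp_sum]
    simp_rw [← mul_assoc]
  rw [integral_congr_ae (ae_of_all _ hprod)]
  rw [integral_fintype_prod_eq_prod (f := fun i (x : ℝ) => Real.exp (-s * μ i * x ^ 2))]
  calc _ ≤ ∏ i, Real.exp (-(s * μ i) / 2) := by
        refine Finset.prod_le_prod (fun i _ => integral_nonneg fun _ => (Real.exp_pos _).le)
          fun i _ => ?_
        have h : s * μ i ≤ 1 := (mul_le_mul_of_nonneg_left (hμC i) hs).trans hsC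
        simpa using integral_exp_neg_mul_sq_gaussianReal_le (mul_nonneg hs (hμ0 i)) h
    _ = _ := by
        rw [← Real.exp_sum, ← htr, ← Finset.sum_div, Finset.sum_neg_distrib, ← Finset.mul_sum,
          neg_mul]

theorem stdGaussian_map_inner (a : F) :
    (stdGaussian F).map (fun g => ⟪a, g⟫) = gaussianReal 0 (‖a‖ ^ 2).toNNReal := by
  have h := IsGaussian.map_eq_gaussianReal (μ := stdGaussian F) (innerSL ℝ a)
  rw [integral_strongDual_stdGaussian, variance_dual_stdGaussian, innerSL_apply_norm] at h
  exact h

theorem stdGaussian_inner_ge_le {a : F} (ha : ‖a‖ ≤ 1) (r : ℝ) :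
    (stdGaussian F).real {g | r ≤ ⟪a, g⟫} ≤ Real.exp (1 / 2 - r) := by
  have hint : Integrable (fun g => Real.exp (1 * ⟪a, g⟫)) (stdGaussian F) := by
    have := integrable_exp_mul_gaussianReal (μ := 0) (v := (‖a‖ ^ 2).toNNReal) 1
    rw [← stdGaussian_map_inner] at this
    exact this.comp_measurable (by fun_prop)
  have h := measure_ge_le_exp_mul_mgf (μ := stdGaussian F) (X := fun g => ⟪a, g⟫) r zero_le_one hint
  rw [mgf_gaussianReal (stdGaussian_map_inner a), ← Real.exp_add] at h
  refine h.trans (Real.exp_le_exp.2 ?_)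
  rw [Real.coe_toNNReal _ (by positivity)]
  nlinarith [norm_nonneg a]

theorem stdGaussian_abs_inner_ge_le {a : F} (ha : ‖a‖ ≤ 1) (r : ℝ) :
    (stdGaussian F).real {g | r ≤ |⟪a, g⟫|} ≤ 2 * Real.exp (1 / 2 - r) := by
  have hsub : {g : F | r ≤ |⟪a, g⟫|} ⊆ {g | r ≤ ⟪a, g⟫} ∪ {g | r ≤ ⟪-a, g⟫} := by
    intro g hg
    simpa [le_abs, inner_neg_left] using hg
  calc _ ≤ _ := measureReal_mono hsub
    _ ≤ _ := measureReal_union_le _ _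
    _ ≤ _ := by
      have h1 := stdGaussian_inner_ge_le ha r
      have h2 := stdGaussian_inner_ge_le (a := -a) (by simpa using ha) r
      linarith

end Gaussian

/-! ### Decay of the characteristic function near the origin. -/

section CharFun

open scoped RealInnerProductSpace

theorem sq_norm_charFun_eq_integral_cos {μ : Measure ℂ} [IsProbabilityMeasure μ] (u : ℂ) :
    ‖charFun μ u‖ ^ 2 = ∫ z, Real.cos ⟪z.1 - z.2, u⟫ ∂(μ.prod μ) := by
  have h1 : ((‖charFun μ u‖ ^ 2 : ℝ) : ℂ) = charFun μ u * charFun μ (-u) := by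
    rw [charFun_neg, Complex.mul_conj, Complex.normSq_eq_norm_sq]
  have h2 : charFun μ u * charFun μ (-u) =
      ∫ z, Complex.exp (⟪z.1, u⟫ * Complex.I) * Complex.exp (⟪z.2, -u⟫ * Complex.I)
        ∂(μ.prod μ) := by
    rw [integral_prod_mul (fun x => Complex.exp (⟪x, u⟫ * Complex.I))
      (fun x => Complex.exp (⟪x, -u⟫ * Complex.I)), charFun_apply, charFun_apply]
  have h3 : ∀ z : ℂ × ℂ,
      Complex.exp (⟪z.1, u⟫ * Complex.I) * Complex.exp (⟪z.2, -u⟫ * Complex.I) =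
      Complex.exp ((⟪z.1 - z.2, u⟫ : ℝ) * Complex.I) := by
    intro z
    rw [← Complex.exp_add, inner_neg_right, inner_sub_left]
    push_cast
    ring_nf
  simp_rw [h3] at h2
  have hint : Integrable (fun z : ℂ × ℂ => Complex.exp ((⟪z.1 - z.2, u⟫ : ℝ) * Complex.I))
      (μ.prod μ) := by
    refine Integrable.of_bound (C := 1) (Measurable.aestronglyMeasurable (by fun_prop)) ?_
    exact ae_of_all _ fun z => (Complex.norm_exp_ofReal_mul_I _).le
  rw [← Complex.ofReal_re (‖charFun μ u‖ ^ 2), h1, h2]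
  have := Complex.reCLM.integral_comp_comm hint
  simp only [Complex.reCLM_apply, Complex.exp_ofReal_mul_I_re] at this
  exact this.symm

theorem integral_prod_norm_sub_sq {μ : Measure ℂ} [IsProbabilityMeasure μ] (h2 : MemLp id 2 μ) :
    ∫ z, ‖z.1 - z.2‖ ^ 2 ∂(μ.prod μ) = 2 * ((∫ x, ‖x‖ ^ 2 ∂μ) - ‖∫ x, x ∂μ‖ ^ 2) := by
  have hi : Integrable (fun x : ℂ => x) μ := h2.integrable (by norm_num)
  have hn : Integrable (fun x : ℂ => ‖x‖ ^ 2) μ := h2.integrable_norm_pow (by norm_num)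
  have hexp : ∀ z : ℂ × ℂ, ‖z.1 - z.2‖ ^ 2 =
      ‖z.1‖ ^ 2 + ‖z.2‖ ^ 2 - 2 * (z.1.re * z.2.re) - 2 * (z.1.im * z.2.im) := by
    intro z
    simp only [← Complex.normSq_eq_norm_sq, Complex.normSq_apply, Complex.sub_re, Complex.sub_im]
    ring
  have hre : Integrable (fun x : ℂ => x.re) μ := hi.re
  have him : Integrable (fun x : ℂ => x.im) μ := hi.im
  have e1 : ∫ z : ℂ × ℂ, ‖z.1‖ ^ 2 ∂(μ.prod μ) = ∫ x, ‖x‖ ^ 2 ∂μ := by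
    simpa using integral_fun_fst (μ := μ) (ν := μ) (fun x : ℂ => ‖x‖ ^ 2)
  have e2 : ∫ z : ℂ × ℂ, ‖z.2‖ ^ 2 ∂(μ.prod μ) = ∫ x, ‖x‖ ^ 2 ∂μ := by
    simpa using integral_fun_snd (μ := μ) (ν := μ) (fun x : ℂ => ‖x‖ ^ 2)
  have r : ∫ x : ℂ, x.re ∂μ = (∫ x, x ∂μ).re := integral_re hi
  have i : ∫ x : ℂ, x.im ∂μ = (∫ x, x ∂μ).im := integral_im hi
  simp_rw [hexp]
  rw [integral_sub, integral_sub, integral_add, integral_const_mul, integral_const_mul,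
    integral_prod_mul (fun x : ℂ => x.re) (fun x : ℂ => x.re),
    integral_prod_mul (fun x : ℂ => x.im) (fun x : ℂ => x.im), e1, e2, r, i,
    ← Complex.normSq_eq_norm_sq, Complex.normSq_apply]
  · ring
  · exact hn.comp_fst μ
  · exact hn.comp_snd μ
  · exact (hn.comp_fst μ).add (hn.comp_snd μ)
  · exact (hre.mul_prod hre).const_mul 2
  · exact ((hn.comp_fst μ).add (hn.comp_snd μ)).sub ((hre.mul_prod hre).const_mul 2)
  · exact (him.mul_prod him).const_mul 2

/-- The larger diagonal entry is at least 1/2; completing the square on it leaves a nonnegative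
remainder. One square is all that can be hoped for, since the covariance of a complex variable may
have rank one. -/
theorem exists_half_sq_le_quadratic {a b c : ℝ} (hac : 1 ≤ a + c)
    (hq : ∀ x y : ℝ, 0 ≤ a * x ^ 2 + 2 * b * (x * y) + c * y ^ 2) :
    ∃ p q : ℝ, |p| ≤ 1 ∧ |q| ≤ 1 ∧ 1 ≤ p ^ 2 + q ^ 2 ∧
      ∀ x y : ℝ, 1 / 2 * (p * x + q * y) ^ 2 ≤ a * x ^ 2 + 2 * b * (x * y) + c * y ^ 2 := by
  wlog h : c ≤ a generalizing a b c
  · obtain ⟨p, q, hp, hq', hpq, H⟩ := this (a := c) (b := b) (c := a) (by linarith)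
      (fun x y => by have := hq y x; linarith) (by linarith)
    exact ⟨q, p, hq', hp, by linarith, fun x y => by have := H y x; linarith⟩
  have ha : 1 / 2 ≤ a := by linarith
  have ha0 : 0 < a := by linarith
  have hdisc : b ^ 2 ≤ a * c := by
    have := hq (-b) a
    have h' : 0 ≤ a * (a * c - b ^ 2) := by nlinarith
    have := nonneg_of_mul_nonneg_right h' ha0
    linarith
  refine ⟨1, b / a, by simp, ?_, by nlinarith [sq_nonneg (b / a)], fun x y => ?_⟩
  · rw [abs_div, abs_of_pos ha0, div_le_one ha0]
    exact abs_le_of_sq_le_sq (by nlinarith) ha0.le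
  · have e : a * x ^ 2 + 2 * b * (x * y) + c * y ^ 2 =
        a * (1 * x + b / a * y) ^ 2 + (a * c - b ^ 2) / a * y ^ 2 := by
      field_simp
      ring
    rw [e]
    have h1 : 0 ≤ (a * c - b ^ 2) / a * y ^ 2 := by
      have : 0 ≤ a * c - b ^ 2 := by linarith
      positivity
    nlinarith [sq_nonneg (1 * x + b / a * y)]

theorem cos_le_one_sub_sq_div_five {x : ℝ} (hx : |x| ≤ 1) : Real.cos x ≤ 1 - x ^ 2 / 5 := by
  have := Real.cos_le_one_sub_mul_cos_sq (hx.trans (by linarith [Real.pi_gt_three]))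
  have hpi : (1 : ℝ) / 5 ≤ 2 / Real.pi ^ 2 := by
    have := Real.pi_lt_d2
    rw [div_le_div_iff₀ (by norm_num) (by positivity)]
    nlinarith [Real.pi_pos]
  nlinarith [sq_nonneg x]

/-- The squared modulus is the mean cosine of the symmetrised variable. On a large ball the cosine
is below a parabola, and the truncated second moments form a quadratic form that dominates a square.
-/
theorem exists_norm_charFun_le {μ : Measure ℂ} [IsProbabilityMeasure μ] (h2 : MemLp id 2 μ)
    (hvar : (∫ x, ‖x‖ ^ 2 ∂μ) - ‖∫ x, x ∂μ‖ ^ 2 = 1) :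
    ∃ p q M : ℝ, |p| ≤ 1 ∧ |q| ≤ 1 ∧ 1 ≤ p ^ 2 + q ^ 2 ∧ 0 < M ∧
      ∀ u : ℂ, M * ‖u‖ ≤ 1 →
        ‖charFun μ u‖ ≤ Real.exp (-(1 / 20) * (p * u.re + q * u.im) ^ 2) := by
  have hd2 : MemLp (fun z : ℂ × ℂ => z.1 - z.2) 2 (μ.prod μ) :=
    (h2.comp_fst μ).sub (h2.comp_snd μ)
  have hdn : Integrable (fun z : ℂ × ℂ => ‖z.1 - z.2‖ ^ 2) (μ.prod μ) :=
    hd2.integrable_norm_pow (by norm_num)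
  have hlim := tendsto_setIntegral_of_monotone (μ := μ.prod μ)
    (f := fun z : ℂ × ℂ => ‖z.1 - z.2‖ ^ 2) (s := fun N : ℕ => {z | ‖z.1 - z.2‖ ≤ N})
    (fun N => measurableSet_le (by fun_prop) (by fun_prop))
    (fun N N' h z (hz : _ ≤ (N : ℝ)) => hz.trans (Nat.cast_le.2 h)) hdn.integrableOn
  have hU : ⋃ N : ℕ, {z : ℂ × ℂ | ‖z.1 - z.2‖ ≤ N} = Set.univ := by
    ext z
    simpa using exists_nat_ge ‖z.1 - z.2‖
  rw [hU, setIntegral_univ, integral_prod_norm_sub_sq h2, hvar] at hlim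
  -- The symmetrised variable has second moment 2, so some truncation retains more than 1.
  obtain ⟨N, hN1, hN⟩ := ((eventually_gt_atTop 0).and
    (hlim.eventually (lt_mem_nhds (show (1 : ℝ) < 2 * 1 by norm_num)))).exists
  set S : Set (ℂ × ℂ) := {z | ‖z.1 - z.2‖ ≤ N} with hSdef
  have hS : MeasurableSet S := measurableSet_le (by fun_prop) (by fun_prop)
  have hbd : ∀ f : ℂ × ℂ → ℝ, Measurable f → (∀ z, |f z| ≤ ‖z.1 - z.2‖ ^ 2) →
      IntegrableOn f S (μ.prod μ) := fun f hf hb =>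
    (hdn.mono' hf.aestronglyMeasurable (ae_of_all _ hb)).integrableOn
  have hnsq : ∀ w : ℂ, ‖w‖ ^ 2 = w.re ^ 2 + w.im ^ 2 := fun w => by
    rw [← Complex.normSq_eq_norm_sq, Complex.normSq_apply]; ring
  have ia := hbd (fun z => (z.1 - z.2).re ^ 2) (by fun_prop) fun z => by
    rw [hnsq, abs_of_nonneg (by positivity)]; nlinarith
  have ic := hbd (fun z => (z.1 - z.2).im ^ 2) (by fun_prop) fun z => by
    rw [hnsq, abs_of_nonneg (by positivity)]; nlinarith
  have ib := hbd (fun z => (z.1 - z.2).re * (z.1 - z.2).im) (by fun_prop) fun z => by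
    rw [hnsq, abs_le]; constructor <;> nlinarith [sq_nonneg ((z.1 - z.2).re + (z.1 - z.2).im),
      sq_nonneg ((z.1 - z.2).re - (z.1 - z.2).im)]
  set a := ∫ z in S, (z.1 - z.2).re ^ 2 ∂(μ.prod μ) with ha
  set b := ∫ z in S, (z.1 - z.2).re * (z.1 - z.2).im ∂(μ.prod μ) with hb
  set c := ∫ z in S, (z.1 - z.2).im ^ 2 ∂(μ.prod μ) with hc
  have hquad : ∀ x y : ℝ, a * x ^ 2 + 2 * b * (x * y) + c * y ^ 2 =
      ∫ z in S, ((z.1 - z.2).re * x + (z.1 - z.2).im * y) ^ 2 ∂(μ.prod μ) := by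
    intro x y
    have e : ∀ z : ℂ × ℂ, ((z.1 - z.2).re * x + (z.1 - z.2).im * y) ^ 2 =
        (z.1 - z.2).re ^ 2 * x ^ 2 + (z.1 - z.2).re * (z.1 - z.2).im * (2 * (x * y)) +
          (z.1 - z.2).im ^ 2 * y ^ 2 := fun z => by ring
    simp_rw [e]
    rw [integral_add, integral_add, integral_mul_const, integral_mul_const, integral_mul_const]
    · ring
    exacts [ia.mul_const _, ib.mul_const _, (ia.mul_const _).add (ib.mul_const _), ic.mul_const _]
  have hac : 1 ≤ a + c := by
    rw [ha, hc, ← integral_add ia ic]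
    simp_rw [← hnsq]
    exact hN.le
  obtain ⟨p, q, hp, hq, hpq, H⟩ := exists_half_sq_le_quadratic hac (b := b) fun x y => by
    rw [hquad]
    exact integral_nonneg fun _ => sq_nonneg _
  refine ⟨p, q, N, hp, hq, hpq, by exact_mod_cast hN1, fun u hu => ?_⟩
  have hinner : ∀ z : ℂ × ℂ, ⟪z.1 - z.2, u⟫ = (z.1 - z.2).re * u.re + (z.1 - z.2).im * u.im := by
    intro z
    simp [Complex.mul_re]
    ring
  have hcos : ∀ z : ℂ × ℂ, Real.cos ⟪z.1 - z.2, u⟫ ≤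
      1 - S.indicator (fun z => ((z.1 - z.2).re * u.re + (z.1 - z.2).im * u.im) ^ 2) z / 5 := by
    intro z
    by_cases hz : z ∈ S
    · rw [Set.indicator_of_mem hz, ← hinner]
      refine cos_le_one_sub_sq_div_five ((abs_real_inner_le_norm _ _).trans (le_trans ?_ hu))
      exact mul_le_mul_of_nonneg_right hz (norm_nonneg _)
    · rw [Set.indicator_of_notMem hz]
      simpa using Real.cos_le_one _
  have iq : IntegrableOn (fun z : ℂ × ℂ => ((z.1 - z.2).re * u.re + (z.1 - z.2).im * u.im) ^ 2) S
      (μ.prod μ) := by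
    have e : ∀ z : ℂ × ℂ, ((z.1 - z.2).re * u.re + (z.1 - z.2).im * u.im) ^ 2 =
        (z.1 - z.2).re ^ 2 * u.re ^ 2 + (z.1 - z.2).re * (z.1 - z.2).im * (2 * (u.re * u.im)) +
          (z.1 - z.2).im ^ 2 * u.im ^ 2 := fun z => by ring
    simp_rw [e]
    exact ((ia.mul_const _).add (ib.mul_const _)).add (ic.mul_const _)
  -- The factor 1/5 from the cosine and 1/2 from the quadratic form give 1/10 for the square, hence
  -- 1/20 for the modulus.
  have hsq : ‖charFun μ u‖ ^ 2 ≤ Real.exp (-(1 / 20) * (p * u.re + q * u.im) ^ 2) ^ 2 := by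
    rw [sq_norm_charFun_eq_integral_cos]
    have hI := (integrable_indicator_iff hS).2 iq
    calc _ ≤ ∫ z, (1 - S.indicator
            (fun z => ((z.1 - z.2).re * u.re + (z.1 - z.2).im * u.im) ^ 2) z / 5) ∂(μ.prod μ) := by
          refine integral_mono ?_ ((integrable_const _).sub (hI.div_const 5)) hcos
          refine Integrable.of_bound (C := 1) (Measurable.aestronglyMeasurable (by fun_prop)) ?_
          exact ae_of_all _ fun z => Real.abs_cos_le_one _
      _ = 1 - (a * u.re ^ 2 + 2 * b * (u.re * u.im) + c * u.im ^ 2) / 5 := by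
          rw [integral_sub (integrable_const _) (hI.div_const 5), integral_div,
            integral_indicator hS, ← hquad]
          simp
      _ ≤ 1 - (1 / 10) * (p * u.re + q * u.im) ^ 2 := by have := H u.re u.im; linarith
      _ ≤ Real.exp (-(1 / 10) * (p * u.re + q * u.im) ^ 2) := by
          have := Real.add_one_le_exp (-(1 / 10) * (p * u.re + q * u.im) ^ 2)
          linarith
      _ = _ := by
          rw [← Real.exp_nat_mul]
          push_cast
          ring_nf
  exact le_of_sq_le_sq hsq (Real.exp_pos _).le

end CharFun

/-! ### Laplace transform of the squared norm of a random sum. -/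

section SmallBall

open scoped RealInnerProductSpace

variable {F : Type*} [NormedAddCommGroup F] [InnerProductSpace ℝ F] {ι : Type*} [Fintype ι]

theorem integral_pi_cexp_inner (μ : Measure ℂ) [IsProbabilityMeasure μ] (a b : ι → F) (w g : F)
    (r : ℝ) :
    ∫ x : ι → ℂ, Complex.exp (⟪g, r • (w + ∑ j, ((x j).re • a j + (x j).im • b j))⟫ * Complex.I)
      ∂(Measure.pi fun _ => μ) =
    Complex.exp (⟪g, r • w⟫ * Complex.I) *
      ∏ j, charFun μ ⟨r * ⟪a j, g⟫, r * ⟪b j, g⟫⟩ := by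
  have e : ∀ x : ι → ℂ,
      Complex.exp (⟪g, r • (w + ∑ j, ((x j).re • a j + (x j).im • b j))⟫ * Complex.I) =
      Complex.exp (⟪g, r • w⟫ * Complex.I) *
        ∏ j, Complex.exp (⟪x j, (⟨r * ⟪a j, g⟫, r * ⟪b j, g⟫⟩ : ℂ)⟫ * Complex.I) := by
    intro x
    rw [← Complex.exp_sum, ← Finset.sum_mul, ← Complex.exp_add, ← add_mul, ← Complex.ofReal_sum,
      ← Complex.ofReal_add, smul_add, inner_add_right, Finset.smul_sum, inner_sum]
    congr 4
    refine Finset.sum_congr rfl fun j _ => ?_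
    rw [Complex.inner, smul_add, inner_add_right, smul_smul, smul_smul, real_inner_smul_right,
      real_inner_smul_right, real_inner_comm, real_inner_comm (b j)]
    simp [Complex.mul_re]
    ring
  simp_rw [e]
  rw [integral_const_mul, integral_fintype_prod_eq_prod
    (f := fun j (z : ℂ) => Complex.exp (⟪z, (⟨r * ⟪a j, g⟫, r * ⟪b j, g⟫⟩ : ℂ)⟫ * Complex.I))]
  simp_rw [charFun_apply]

variable [FiniteDimensional ℝ F] [MeasurableSpace F] [BorelSpace F]

theorem charFun_stdGaussian_sqrt_smul {t : ℝ} (ht : 0 ≤ t) (v : F) :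
    charFun (stdGaussian F) (√(2 * t) • v) = (Real.exp (-t * ‖v‖ ^ 2) : ℝ) := by
  rw [charFun_stdGaussian, norm_smul, Real.norm_of_nonneg (Real.sqrt_nonneg _)]
  push_cast
  rw [mul_pow, ← Complex.ofReal_pow (√(2 * t)), Real.sq_sqrt (by positivity)]
  push_cast
  ring_nf

/-- Writing exp(-t‖v‖²) as the Gaussian characteristic function at √(2t) v and exchanging integrals
lets the independent coordinates factor. The shift w contributes only a phase. -/
theorem integral_pi_exp_neg_norm_sq_le (μ : Measure ℂ) [IsProbabilityMeasure μ] (a b : ι → F)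
    (w : F) {t : ℝ} (ht : 0 ≤ t) :
    ∫ x : ι → ℂ, Real.exp (-t * ‖w + ∑ j, ((x j).re • a j + (x j).im • b j)‖ ^ 2)
      ∂(Measure.pi fun _ => μ) ≤
    ∫ g, ∏ j, ‖charFun μ ⟨√(2 * t) * ⟪a j, g⟫, √(2 * t) * ⟪b j, g⟫⟩‖ ∂(stdGaussian F) := by
  have hint : Integrable (Function.uncurry fun (x : ι → ℂ) (g : F) =>
      Complex.exp (⟪g, √(2 * t) • (w + ∑ j, ((x j).re • a j + (x j).im • b j))⟫ * Complex.I))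
      ((Measure.pi fun _ => μ).prod (stdGaussian F)) := by
    refine Integrable.of_bound (C := 1) (Measurable.aestronglyMeasurable ?_) ?_
    · simp only [Function.uncurry_def]
      fun_prop
    · exact ae_of_all _ fun z => (Complex.norm_exp_ofReal_mul_I _).le
  have key : ((∫ x : ι → ℂ, Real.exp (-t * ‖w + ∑ j, ((x j).re • a j + (x j).im • b j)‖ ^ 2)
      ∂(Measure.pi fun _ => μ) : ℝ) : ℂ) = ∫ g, Complex.exp (⟪g, √(2 * t) • w⟫ * Complex.I) *
      ∏ j, charFun μ ⟨√(2 * t) * ⟪a j, g⟫, √(2 * t) * ⟪b j, g⟫⟩ ∂(stdGaussian F) := by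
    rw [← integral_complex_ofReal]
    simp_rw [← charFun_stdGaussian_sqrt_smul ht, charFun_apply (μ := stdGaussian F)]
    rw [integral_integral_swap hint]
    simp_rw [integral_pi_cexp_inner]
  have hnn : 0 ≤ ∫ x : ι → ℂ, Real.exp (-t * ‖w + ∑ j, ((x j).re • a j + (x j).im • b j)‖ ^ 2)
      ∂(Measure.pi fun _ => μ) := integral_nonneg fun _ => (Real.exp_pos _).le
  rw [← Real.norm_of_nonneg hnn, ← Complex.norm_real, key]
  refine (norm_integral_le_integral_norm _).trans (le_of_eq ?_)
  simp_rw [norm_mul, Complex.norm_exp_ofReal_mul_I, one_mul, norm_prod]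

/-- Laplace transform bound for the squared norm of a random linear combination. -/
theorem integral_pi_exp_neg_norm_sq_le_of_charFun_le (μ : Measure ℂ) [IsProbabilityMeasure μ]
    {p q M : ℝ} (hp : |p| ≤ 1) (hq : |q| ≤ 1) (hpq : 1 ≤ p ^ 2 + q ^ 2) (hM : 0 < M)
    (hμ : ∀ u : ℂ, M * ‖u‖ ≤ 1 →
        ‖charFun μ u‖ ≤ Real.exp (-(1 / 20) * (p * u.re + q * u.im) ^ 2))
    (a b : ι → F) (hframe : ∀ g, ∑ j, (⟪a j, g⟫ ^ 2 + ⟪b j, g⟫ ^ 2) ≤ ‖g‖ ^ 2)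
    (hab : ∀ j, ⟪a j, b j⟫ = 0) (hnorm : ∀ j, ‖a j‖ = ‖b j‖) (w : F) {t : ℝ} (ht : 0 < t)
    (ht1 : t ≤ 1) :
    ∫ x : ι → ℂ, Real.exp (-t * ‖w + ∑ j, ((x j).re • a j + (x j).im • b j)‖ ^ 2)
      ∂(Measure.pi fun _ => μ) ≤
    Real.exp (-t * (∑ j, ‖a j‖ ^ 2) / 20) +
      4 * Fintype.card ι * Real.exp (1 / 2 - 1 / (2 * M * √(2 * t))) := by
  -- Below this threshold for both inner products, the argument u of the characteristic function
  -- satisfies M‖u‖ ≤ 1.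
  set r := 1 / (2 * M * √(2 * t)) with hr
  have hst : 0 < √(2 * t) := by positivity
  have hr0 : 0 < r := by positivity
  have ha1 : ∀ j, ‖a j‖ ≤ 1 := by
    intro j
    have h1 : ⟪a j, a j⟫ ^ 2 + ⟪b j, a j⟫ ^ 2 ≤ ‖a j‖ ^ 2 :=
      (Finset.single_le_sum (f := fun j' => ⟪a j', a j⟫ ^ 2 + ⟪b j', a j⟫ ^ 2)
        (fun _ _ => by positivity) (Finset.mem_univ j)).trans (hframe (a j))
    rw [real_inner_self_eq_norm_sq] at h1
    by_contra! h
    have h2 : 1 < ‖a j‖ ^ 2 := one_lt_pow₀ h two_ne_zero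
    nlinarith [sq_nonneg (⟪b j, a j⟫)]
  have hb1 : ∀ j, ‖b j‖ ≤ 1 := fun j => hnorm j ▸ ha1 j
  set f : ι → F := fun j => p • a j + q • b j with hf
  have hfin : ∀ j g, ⟪f j, g⟫ = p * ⟪a j, g⟫ + q * ⟪b j, g⟫ := by
    intro j g
    simp [hf, inner_add_left, real_inner_smul_left]
  have hp2 : p ^ 2 ≤ 1 := by rw [← sq_abs]; nlinarith [abs_nonneg p]
  have hq2 : q ^ 2 ≤ 1 := by rw [← sq_abs]; nlinarith [abs_nonneg q]
  have hfC : ∀ g, ∑ j, ⟪f j, g⟫ ^ 2 ≤ 2 * ‖g‖ ^ 2 := by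
    intro g
    refine le_trans ?_ (mul_le_mul_of_nonneg_left (hframe g) zero_le_two)
    rw [Finset.mul_sum]
    refine Finset.sum_le_sum fun j _ => ?_
    rw [hfin]
    nlinarith [sq_nonneg (p * ⟪b j, g⟫ - q * ⟪a j, g⟫), sq_nonneg (⟪a j, g⟫),
      sq_nonneg (⟪b j, g⟫)]
  -- Orthogonality and equal norms give ‖f j‖² = (p² + q²)‖a j‖², so a single real direction of
  -- decay loses nothing.
  have hfn : ∀ j, ‖a j‖ ^ 2 ≤ ‖f j‖ ^ 2 := by
    intro j
    rw [← real_inner_self_eq_norm_sq (f j), hfin]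
    simp only [hf, inner_add_right, real_inner_smul_right, real_inner_comm (a j) (b j), hab,
      real_inner_self_eq_norm_sq, ← hnorm]
    nlinarith [sq_nonneg ‖a j‖]
  -- The scale s is (1/20)·(√(2t))² = t/10.
  have hG := integral_exp_neg_sum_sq_inner_stdGaussian_le f (s := t / 10) hfC (by positivity)
    (by linarith)
  let Sa : ι → Set F := fun j => {g | r ≤ |⟪a j, g⟫|}
  let Sb : ι → Set F := fun j => {g | r ≤ |⟪b j, g⟫|}
  have hSa : ∀ j, MeasurableSet (Sa j) := fun j => measurableSet_le (by fun_prop) (by fun_prop)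
  have hSb : ∀ j, MeasurableSet (Sb j) := fun j => measurableSet_le (by fun_prop) (by fun_prop)
  have hpt : ∀ g, ∏ j, ‖charFun μ ⟨√(2 * t) * ⟪a j, g⟫, √(2 * t) * ⟪b j, g⟫⟩‖ ≤
      Real.exp (-(t / 10) * ∑ j, ⟪f j, g⟫ ^ 2) +
        ∑ j, ((Sa j).indicator 1 g + (Sb j).indicator 1 g) := by
    intro g
    have hind : ∀ S : Set F, (0 : ℝ) ≤ S.indicator 1 g := fun S =>
      Set.indicator_nonneg (fun _ _ => zero_le_one) g
    have hnn : ∀ j, (0 : ℝ) ≤ (Sa j).indicator 1 g + (Sb j).indicator 1 g := fun j =>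
      add_nonneg (hind _) (hind _)
    by_cases hg : ∀ j, |⟪a j, g⟫| < r ∧ |⟪b j, g⟫| < r
    · refine le_trans ?_ (le_add_of_nonneg_right (Finset.sum_nonneg fun j _ => hnn j))
      rw [Finset.mul_sum, Real.exp_sum]
      refine Finset.prod_le_prod (fun _ _ => norm_nonneg _) fun j _ => ?_
      refine (hμ _ ?_).trans (Real.exp_le_exp.2 (le_of_eq ?_))
      · have h1 := Complex.norm_le_abs_re_add_abs_im
          (⟨√(2 * t) * ⟪a j, g⟫, √(2 * t) * ⟪b j, g⟫⟩ : ℂ)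
        simp only [abs_mul, abs_of_pos hst] at h1
        have h2 : √(2 * t) * |⟪a j, g⟫| + √(2 * t) * |⟪b j, g⟫| ≤ √(2 * t) * (2 * r) := by
          rw [← mul_add]
          exact mul_le_mul_of_nonneg_left (by linarith [(hg j).1, (hg j).2]) hst.le
        calc _ ≤ M * (√(2 * t) * (2 * r)) := mul_le_mul_of_nonneg_left (h1.trans h2) hM.le
          _ = 1 := by rw [hr]; field_simp
      · rw [hfin]
        have : √(2 * t) ^ 2 = 2 * t := Real.sq_sqrt (by positivity)
        linear_combination (-(1 / 20) * (p * ⟪a j, g⟫ + q * ⟪b j, g⟫) ^ 2) * this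
    · push Not at hg
      obtain ⟨j, hj⟩ := hg
      have h1 : ∏ j, ‖charFun μ ⟨√(2 * t) * ⟪a j, g⟫, √(2 * t) * ⟪b j, g⟫⟩‖ ≤ 1 :=
        Finset.prod_le_one (fun _ _ => norm_nonneg _) fun _ _ => norm_charFun_le_one _
      have h2 : (1 : ℝ) ≤ (Sa j).indicator 1 g + (Sb j).indicator 1 g := by
        by_cases h : r ≤ |⟪a j, g⟫|
        · rw [Set.indicator_of_mem (show g ∈ Sa j from h)]
          exact le_add_of_nonneg_right (hind _)
        · rw [Set.indicator_of_mem (show g ∈ Sb j from hj (not_le.1 h))]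
          exact le_add_of_nonneg_left (hind _)
      have h3 := Finset.single_le_sum
        (f := fun j => (Sa j).indicator (1 : F → ℝ) g + (Sb j).indicator 1 g)
        (fun j _ => hnn j) (Finset.mem_univ j)
      have h4 := Real.exp_pos (-(t / 10) * ∑ j, ⟪f j, g⟫ ^ 2)
      linarith
  have hi1 : Integrable (fun g => Real.exp (-(t / 10) * ∑ j, ⟪f j, g⟫ ^ 2)) (stdGaussian F) := by
    refine Integrable.of_bound (C := 1) (Measurable.aestronglyMeasurable (by fun_prop)) ?_
    refine ae_of_all _ fun g => ?_
    rw [Real.norm_of_nonneg (Real.exp_pos _).le, Real.exp_le_one_iff]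
    have : 0 ≤ ∑ j, ⟪f j, g⟫ ^ 2 := by positivity
    nlinarith
  have hia : ∀ j, Integrable ((Sa j).indicator (1 : F → ℝ)) (stdGaussian F) := fun j =>
    (integrable_const (1 : ℝ)).indicator (hSa j)
  have hib : ∀ j, Integrable ((Sb j).indicator (1 : F → ℝ)) (stdGaussian F) := fun j =>
    (integrable_const (1 : ℝ)).indicator (hSb j)
  have hi2 : Integrable (fun g => ∑ j, ((Sa j).indicator (1 : F → ℝ) g + (Sb j).indicator 1 g))
      (stdGaussian F) := integrable_finsetSum _ fun j _ => (hia j).add (hib j)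
  refine (integral_pi_exp_neg_norm_sq_le μ a b w ht.le).trans ?_
  refine (integral_mono_of_nonneg (ae_of_all _ fun g => Finset.prod_nonneg fun _ _ =>
    norm_nonneg _) (hi1.add hi2) (ae_of_all _ hpt)).trans ?_
  simp only [Pi.add_apply]
  rw [integral_add hi1 hi2]
  refine add_le_add (hG.trans (Real.exp_le_exp.2 ?_)) ?_
  · have := Finset.sum_le_sum fun j (_ : j ∈ Finset.univ) => hfn j
    nlinarith
  · rw [integral_finsetSum (f := fun j g => (Sa j).indicator (1 : F → ℝ) g + (Sb j).indicator 1 g)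
      _ fun j _ => (hia j).add (hib j)]
    have : ∀ j ∈ Finset.univ, ∫ g, ((Sa j).indicator (1 : F → ℝ) g + (Sb j).indicator 1 g)
        ∂(stdGaussian F) ≤ 4 * Real.exp (1 / 2 - r) := by
      intro j _
      rw [integral_add (hia j) (hib j), integral_indicator_one (hSa j),
        integral_indicator_one (hSb j)]
      linarith [stdGaussian_abs_inner_ge_le (ha1 j) r, stdGaussian_abs_inner_ge_le (hb1 j) r]
    refine (Finset.sum_le_sum this).trans (le_of_eq ?_)
    simp
    ring

end SmallBall

/-! ### Small ball estimate in complex spaces. -/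

section SmallBallComplex

variable {V : Type*} [NormedAddCommGroup V] [InnerProductSpace ℂ V] [FiniteDimensional ℂ V]
  {ι : Type*} [Fintype ι]

/-- Markov's inequality for exp(-t‖·‖²). Over the reals, `e j` and `I • e j` are orthogonal of equal
norm, as the Laplace bound requires. The level K/40 is half the rate K/20 of the main term, so a
factor exp(-tK/40) survives. -/
theorem measureReal_norm_sq_lt_le (μ : Measure ℂ) [IsProbabilityMeasure μ]
    {p q M : ℝ} (hp : |p| ≤ 1) (hq : |q| ≤ 1) (hpq : 1 ≤ p ^ 2 + q ^ 2) (hM : 0 < M)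
    (hμ : ∀ u : ℂ, M * ‖u‖ ≤ 1 →
        ‖charFun μ u‖ ≤ Real.exp (-(1 / 20) * (p * u.re + q * u.im) ^ 2))
    (e : ι → V) (hframe : ∀ g, ∑ j, ‖inner ℂ (e j) g‖ ^ 2 ≤ ‖g‖ ^ 2) (w : V) {K t : ℝ}
    (hK : K ≤ ∑ j, ‖e j‖ ^ 2) (ht : 0 < t) (ht1 : t ≤ 1) :
    (Measure.pi fun _ => μ).real {x : ι → ℂ | ‖w + ∑ j, x j • e j‖ ^ 2 ≤ K / 40} ≤
      Real.exp (t * K / 40) * (Real.exp (-t * K / 20) +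
        4 * Fintype.card ι * Real.exp (1 / 2 - 1 / (2 * M * √(2 * t)))) := by
  let _ : InnerProductSpace ℝ V := InnerProductSpace.complexToReal
  let _ : MeasurableSpace V := borel V
  have : BorelSpace V := ⟨rfl⟩
  have : FiniteDimensional ℝ V := FiniteDimensional.complexToReal V
  have hre : ∀ x y : V, inner ℝ x y = (inner ℂ x y).re := fun _ _ => rfl
  have hsm : ∀ x : ι → ℂ, ∑ j, x j • e j =
      ∑ j, ((x j).re • e j + (x j).im • (Complex.I • e j)) := by
    intro x
    refine Finset.sum_congr rfl fun j _ => ?_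
    conv_lhs => rw [← Complex.re_add_im (x j), add_smul, mul_smul]
    simp only [Complex.coe_smul]
  have hL := integral_pi_exp_neg_norm_sq_le_of_charFun_le μ hp hq hpq hM hμ e
    (fun j => Complex.I • e j) (fun g => ?_) (fun j => ?_) (fun j => ?_) w ht ht1
  · simp_rw [← hsm] at hL
    have hi : Integrable (fun x : ι → ℂ => Real.exp (-t * ‖w + ∑ j, x j • e j‖ ^ 2))
        (Measure.pi fun _ => μ) := by
      refine Integrable.of_bound (C := 1) (Measurable.aestronglyMeasurable (by fun_prop)) ?_
      refine ae_of_all _ fun g => ?_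
      rw [Real.norm_of_nonneg (Real.exp_pos _).le, Real.exp_le_one_iff]
      have : 0 ≤ ‖w + ∑ j, g j • e j‖ ^ 2 := by positivity
      nlinarith
    have hmk := mul_meas_ge_le_integral_of_nonneg (ae_of_all _ fun _ => (Real.exp_pos _).le) hi
      (Real.exp (-(t * K / 40)))
    have hsub : {x : ι → ℂ | ‖w + ∑ j, x j • e j‖ ^ 2 ≤ K / 40} ⊆
        {x | Real.exp (-(t * K / 40)) ≤ Real.exp (-t * ‖w + ∑ j, x j • e j‖ ^ 2)} := by
      intro x hx
      rw [Set.mem_ofPred_eq] at hx ⊢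
      refine Real.exp_le_exp.2 ?_
      nlinarith
    have h1 : Real.exp (-t * (∑ j, ‖e j‖ ^ 2) / 20) ≤ Real.exp (-t * K / 20) :=
      Real.exp_le_exp.2 (by nlinarith)
    refine (measureReal_mono hsub).trans ?_
    rw [← inv_mul_le_iff₀ (Real.exp_pos _), ← Real.exp_neg]
    refine hmk.trans (hL.trans ?_)
    exact add_le_add h1 le_rfl
  · refine le_trans (le_of_eq (Finset.sum_congr rfl fun j _ => ?_)) (hframe g)
    rw [hre, hre, inner_smul_left, ← Complex.normSq_eq_norm_sq, Complex.normSq_apply]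
    simp
    ring
  · rw [hre, inner_smul_right, inner_self_eq_norm_sq_to_K]
    simp [← Complex.ofReal_pow]
  · rw [norm_smul]
    simp

end SmallBallComplex

/-! ### Distance of a random vector to a subspace. -/

section Distance

/-- Both sides are the trace of the projection. It serves both the distance estimate and the choice
of a good column. -/
theorem sum_norm_sq_orthogonalProjectionOnto {𝕜 E ι : Type*} [RCLike 𝕜] [NormedAddCommGroup E]
    [InnerProductSpace 𝕜 E] [FiniteDimensional 𝕜 E] [Fintype ι] (b : OrthonormalBasis ι 𝕜 E)
    (U : Submodule 𝕜 E) :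
    ∑ i, ‖U.orthogonalProjectionOnto (b i)‖ ^ 2 = Module.finrank 𝕜 U := by
  let c := stdOrthonormalBasis 𝕜 U
  have h : ∀ i, ‖U.orthogonalProjectionOnto (b i)‖ ^ 2 = ∑ a, ‖inner 𝕜 (c a : E) (b i)‖ ^ 2 := by
    intro i
    rw [← c.sum_sq_norm_inner_right]
    refine Finset.sum_congr rfl fun a _ => ?_
    rw [Submodule.inner_orthogonalProjectionOnto_eq_of_mem_left]
  simp_rw [h]
  rw [Finset.sum_comm]
  simp_rw [b.sum_sq_norm_inner_left, Submodule.norm_coe, c.norm_eq_one]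
  simp

theorem exists_time_smallBall_bound_le {M : ℝ} (hM : 0 < M) :
    ∀ᶠ n : ℕ in atTop, ∀ K : ℝ, √n / 2 ≤ K → ∃ t : ℝ, 0 < t ∧ t ≤ 1 ∧
      Real.exp (t * K / 40) * (Real.exp (-t * K / 20) +
        4 * n * Real.exp (1 / 2 - 1 / (2 * M * √(2 * t)))) ≤ 1 / (n : ℝ) ^ 4 := by
  have hy : Tendsto (fun n : ℕ => (n : ℝ) ^ (1 / 8 : ℝ)) atTop atTop :=
    (tendsto_rpow_atTop (by norm_num)).comp tendsto_natCast_atTop_atTop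
  have h1 : Tendsto (fun y : ℝ => 5 * 80 ^ 40 * ((y / 80) ^ 40 * Real.exp (-(y / 80))))
      atTop (nhds (5 * 80 ^ 40 * 0)) :=
    ((Real.tendsto_pow_mul_exp_neg_atTop_nhds_zero 40).comp
      (tendsto_id.atTop_div_const (by norm_num))).const_mul _
  rw [mul_zero] at h1
  have h2 := hy.eventually (h1.eventually (gt_mem_nhds (zero_lt_one)))
  filter_upwards [h2, hy.eventually_ge_atTop (2 * (M + 1) ^ 2), hy.eventually_ge_atTop 4,
    eventually_ge_atTop 1] with n hn hnM hn2 hn1 K hK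
  set y := (n : ℝ) ^ (1 / 8 : ℝ) with hydef
  have hn0 : (1 : ℝ) ≤ n := by exact_mod_cast hn1
  have hy8 : y ^ 8 = n := by
    rw [hydef, ← Real.rpow_natCast, ← Real.rpow_mul (by positivity)]
    norm_num
  have hy0 : 0 ≤ y := by positivity
  have hy4 : √n = y ^ 4 := by
    rw [Real.sqrt_eq_iff_mul_self_eq (by positivity) (by positivity), ← hy8]
    ring
  have hKpos : 0 < K := lt_of_lt_of_le (by positivity) hK
  set l := K ^ (1 / 8 : ℝ) with hl
  have hl0 : 0 < l := by positivity
  have hl8 : l ^ 8 = K := by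
    rw [hl, ← Real.rpow_natCast, ← Real.rpow_mul hKpos.le]
    norm_num
  have hl2 : y / 2 ≤ l ^ 2 := by
    refine le_of_pow_le_pow_left₀ (n := 4) (by norm_num) (by positivity) ?_
    rw [← pow_mul, hl8]
    refine le_trans ?_ hK
    rw [hy4, div_pow]
    nlinarith [pow_nonneg hy0 4]
  have hl1 : 1 ≤ l := by
    by_contra! h
    nlinarith
  have hlM : M + 1 ≤ l := by
    refine le_of_sq_le_sq ?_ hl0.le
    linarith
  -- With K = l⁸ this is t = K^(-3/4): then tK = l², while the Gaussian tail exponent is of order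
  -- l³/M and dominates once l > M. Since l² ≥ n^(1/8)/2, the result beats any power of n.
  refine ⟨(l ^ 6)⁻¹, by positivity, inv_le_one_of_one_le₀ (one_le_pow₀ hl1), ?_⟩
  have htK : (l ^ 6)⁻¹ * K = l ^ 2 := by
    rw [← hl8]
    field_simp
  have hst : √(2 * (l ^ 6)⁻¹) ≤ 3 / 2 / l ^ 3 := by
    rw [Real.sqrt_le_left (by positivity), div_pow, ← pow_mul, ← div_eq_mul_inv]
    gcongr
    norm_num
  have hlow : l ^ 3 / (3 * M) ≤ 1 / (2 * M * √(2 * (l ^ 6)⁻¹)) := by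
    rw [div_le_div_iff₀ (by positivity) (by positivity)]
    calc _ ≤ l ^ 3 * (2 * M * (3 / 2 / l ^ 3)) := by gcongr
      _ = _ := by field_simp
  have hexp : 1 / 2 - 1 / (2 * M * √(2 * (l ^ 6)⁻¹)) ≤ -l ^ 2 / 20 := by
    have : l ^ 2 / 3 ≤ l ^ 3 / (3 * M) := by
      rw [div_le_div_iff₀ (by positivity) (by positivity)]
      have : 0 ≤ l ^ 2 * (l - M) := mul_nonneg (by positivity) (by linarith)
      nlinarith
    nlinarith
  have hfin : 5 * (n : ℝ) ^ 5 * Real.exp (-(y / 80)) ≤ 1 := by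
    refine le_trans (le_of_eq ?_) hn.le
    rw [← hy8]
    ring
  have hexp2 : Real.exp (-(l ^ 2 / 40)) ≤ Real.exp (-(y / 80)) :=
    Real.exp_le_exp.2 (by linarith)
  have hKt : -(l ^ 6)⁻¹ * K = -l ^ 2 := by rw [neg_mul, htK]
  rw [htK, hKt, le_div_iff₀ (by positivity)]
  calc _ ≤ Real.exp (l ^ 2 / 40) * (Real.exp (-l ^ 2 / 20) + 4 * n * Real.exp (-l ^ 2 / 20)) *
        (n : ℝ) ^ 4 := by gcongr
    _ = (1 + 4 * n) * n ^ 4 * Real.exp (-(l ^ 2 / 40)) := by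
        have : Real.exp (l ^ 2 / 40) * Real.exp (-l ^ 2 / 20) = Real.exp (-(l ^ 2 / 40)) := by
          rw [← Real.exp_add]
          ring_nf
        rw [← this]
        ring
    _ ≤ 5 * (n : ℝ) ^ 5 * Real.exp (-(y / 80)) := by
        refine mul_le_mul ?_ hexp2 (Real.exp_pos _).le (by positivity)
        rw [pow_succ (n : ℝ) 4]
        nlinarith [pow_nonneg (zero_le_one.trans hn0) 4]
    _ ≤ 1 := hfin

/-- A random vector with independent identically distributed entries of variance one is with
overwhelming probability far from any given affine subspace of codimension at least `√n / 2`. -/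
theorem eventually_measureReal_exists_mem_submodule_le (μ : Measure ℂ) [IsProbabilityMeasure μ]
    (h2 : MemLp id 2 μ) (hvar : (∫ x, ‖x‖ ^ 2 ∂μ) - ‖∫ x, x ∂μ‖ ^ 2 = 1) :
    ∀ᶠ n : ℕ in atTop, ∀ (H : Submodule ℂ (EuclideanSpace ℂ (Fin n)))
      (v : EuclideanSpace ℂ (Fin n)) (K : ℝ), √n / 2 ≤ K → K ≤ Module.finrank ℂ Hᗮ →
      (Measure.pi fun _ => μ).real
        {x : Fin n → ℂ | ∃ h ∈ H, ‖WithLp.toLp 2 x + v - h‖ ^ 2 < K / 40} ≤ 1 / (n : ℝ) ^ 4 := by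
  obtain ⟨p, q, M, hp, hq, hpq, hM, hμ⟩ := exists_norm_charFun_le h2 hvar
  filter_upwards [exists_time_smallBall_bound_le hM] with n hn H v K hK hKH
  obtain ⟨t, ht, ht1, hb⟩ := hn K hK
  let b := EuclideanSpace.basisFun (Fin n) ℂ
  refine le_trans ?_ ((measureReal_norm_sq_lt_le μ hp hq hpq hM hμ
    (fun j => Hᗮ.orthogonalProjectionOnto (b j)) (fun g => le_of_eq ?_)
    (Hᗮ.orthogonalProjectionOnto v) (hKH.trans_eq ?_) ht ht1).trans ?_)
  · refine measureReal_mono ?_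
    rintro x ⟨h, hH, hx⟩
    rw [Set.mem_ofPred_eq]
    have e : Hᗮ.orthogonalProjectionOnto v + ∑ j, x j • Hᗮ.orthogonalProjectionOnto (b j) =
        Hᗮ.orthogonalProjectionOnto (WithLp.toLp 2 x + v - h) := by
      have hx : WithLp.toLp 2 x = ∑ j, x j • b j := by
        conv_lhs => rw [← b.sum_repr (WithLp.toLp 2 x)]
        simp [b]
      have hh : Hᗮ.orthogonalProjectionOnto h = 0 := by
        rw [Submodule.orthogonalProjectionOnto_eq_zero_iff]
        exact Submodule.le_orthogonal_orthogonal H hH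
      rw [map_sub, map_add, hh, hx, map_sum, sub_zero, add_comm]
      simp_rw [map_smul]
    rw [e]
    refine le_trans ?_ hx.le
    gcongr
    exact Submodule.norm_orthogonalProjectionOnto_apply_le _ _
  · rw [← Submodule.norm_coe, ← b.sum_sq_norm_inner_right (g : EuclideanSpace ℂ (Fin n))]
    refine Finset.sum_congr rfl fun j _ => ?_
    rw [Submodule.inner_orthogonalProjectionOnto_eq_of_mem_right]
  · exact (sum_norm_sq_orthogonalProjectionOnto b Hᗮ).symm
  · simpa using hb

end Distance

/-! ### From singular values to column distances. -/

section LinearAlgebra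

theorem norm_apply_le_singularValues_mul {𝕜 E F : Type*} [RCLike 𝕜] [NormedAddCommGroup E]
    [InnerProductSpace 𝕜 E] [FiniteDimensional 𝕜 E] [NormedAddCommGroup F] [InnerProductSpace 𝕜 F]
    [FiniteDimensional 𝕜 F] (T : E →ₗ[𝕜] F) {n : ℕ} (hn : Module.finrank 𝕜 E = n) {k : ℕ} {x : E}
    (hx : ∀ i : Fin n, (i : ℕ) < k →
      inner 𝕜 (T.isSymmetric_adjoint_comp_self.eigenvectorBasis hn i) x = 0) :
    ‖T x‖ ≤ T.singularValues k * ‖x‖ := by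
  set b := T.isSymmetric_adjoint_comp_self.eigenvectorBasis hn with hb
  have h1 : ‖T x‖ ^ 2 = ∑ i : Fin n, T.singularValues i ^ 2 * ‖inner 𝕜 (b i) x‖ ^ 2 := by
    have h2 : ((‖T x‖ ^ 2 : ℝ) : 𝕜) = inner 𝕜 x ((T.adjoint ∘ₗ T) x) := by
      rw [LinearMap.comp_apply, LinearMap.adjoint_inner_right, inner_self_eq_norm_sq_to_K]
      norm_cast
    have h3 : ∀ i, inner 𝕜 (b i) ((T.adjoint ∘ₗ T) x) =
        ((T.singularValues i ^ 2 : ℝ) : 𝕜) * inner 𝕜 (b i) x := by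
      intro i
      rw [← T.isSymmetric_adjoint_comp_self (b i) x, hb,
        T.isSymmetric_adjoint_comp_self.apply_eigenvectorBasis, inner_smul_left, RCLike.conj_ofReal,
        T.sq_singularValues_fin hn]
    rw [← b.sum_inner_mul_inner] at h2
    simp_rw [h3] at h2
    have h4 : ∀ i, inner 𝕜 x (b i) * (((T.singularValues i ^ 2 : ℝ) : 𝕜) * inner 𝕜 (b i) x) =
        ((T.singularValues i ^ 2 * ‖inner 𝕜 (b i) x‖ ^ 2 : ℝ) : 𝕜) := by
      intro i
      rw [mul_left_comm, ← inner_conj_symm x, RCLike.conj_mul]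
      norm_cast
    simp_rw [h4] at h2
    exact_mod_cast h2
  have h5 : ‖T x‖ ^ 2 ≤ (T.singularValues k * ‖x‖) ^ 2 := by
    rw [h1, mul_pow, ← b.sum_sq_norm_inner_right x, Finset.mul_sum]
    refine Finset.sum_le_sum fun i _ => ?_
    by_cases hi : (i : ℕ) < k
    · rw [hx i hi]
      simp
    · gcongr
      · exact T.singularValues_nonneg _
      · exact T.singularValues_antitone (not_lt.1 hi)
  exact le_of_sq_le_sq h5 (mul_nonneg (T.singularValues_nonneg k) (norm_nonneg x))

theorem finrank_le_finrank_orthogonal_span_add_card {𝕜 E ι : Type*} [RCLike 𝕜]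
    [NormedAddCommGroup E] [InnerProductSpace 𝕜 E] [FiniteDimensional 𝕜 E] [Fintype ι] (u : ι → E) :
    Module.finrank 𝕜 E ≤
      Module.finrank 𝕜 (Submodule.span 𝕜 (Set.range u))ᗮ + Fintype.card ι := by
  have h1 := Submodule.finrank_add_finrank_orthogonal (Submodule.span 𝕜 (Set.range u))
  have h2 := finrank_range_le_card (R := 𝕜) u
  rw [Set.finrank] at h2
  omega

/-- The `k`-th column of a matrix, as a Euclidean vector. -/
def euclideanCol {n : ℕ} (A : Matrix (Fin n) (Fin n) ℂ) (l : Fin n) : EuclideanSpace ℂ (Fin n) :=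
  WithLp.toLp 2 fun a => A a l

theorem toEuclideanLin_eq_sum_col {n : ℕ} (A : Matrix (Fin n) (Fin n) ℂ)
    (x : EuclideanSpace ℂ (Fin n)) :
    Matrix.toEuclideanLin A x = ∑ l, x l • euclideanCol A l := by
  ext a
  simp [Matrix.toLpLin_apply, Matrix.mulVec, dotProduct, euclideanCol, mul_comm]

/-- Dropping about i/2 columns leaves room for their span to have large codimension, while U still
has dimension at least i/2. -/
theorem exists_sqrt_mul_norm_col_sub_le_singularValue {n i : ℕ} (A : Matrix (Fin n) (Fin n) ℂ)
    (hi : i < n) :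
    ∃ j : Fin n, ∃ y ∈ Submodule.span ℂ
      (euclideanCol A '' {l : Fin n | (l : ℕ) < n - (i + 1) / 2 ∧ l ≠ j}),
      √((i : ℝ) / 2 / n) * ‖euclideanCol A j - y‖ ≤ singularValue A (n - i) := by
  set T := Matrix.toEuclideanLin A with hT
  set h := (i + 1) / 2 with hh
  -- The zero-based index of the singular value numbered n - i, hence also the number of singular
  -- vectors to avoid.
  set k := n - i - 1 with hk
  have hfr : Module.finrank ℂ (EuclideanSpace ℂ (Fin n)) = n := finrank_euclideanSpace_fin
  let b := EuclideanSpace.basisFun (Fin n) ℂ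
  let v := T.isSymmetric_adjoint_comp_self.eigenvectorBasis hfr
  let u : {l : Fin n // (l : ℕ) < k} ⊕ {l : Fin n // n - h ≤ (l : ℕ)} → EuclideanSpace ℂ (Fin n) :=
    Sum.elim (fun l => v l) (fun l => b l)
  set U := (Submodule.span ℂ (Set.range u))ᗮ with hU
  have hbl : ∀ (l : Fin n) (x : EuclideanSpace ℂ (Fin n)), inner ℂ (b l) x = x l := fun l x => by
    simp [b, EuclideanSpace.inner_single_left]
  have hmem : ∀ x ∈ U, ∀ s, inner ℂ (u s) x = 0 := fun x hx s =>
    Submodule.inner_right_of_mem_orthogonal (Submodule.subset_span (Set.mem_range_self s)) hx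
  have hd : i + 1 - h ≤ Module.finrank ℂ U := by
    have h1 := finrank_le_finrank_orthogonal_span_add_card (𝕜 := ℂ) u
    have h2 : Fintype.card {l : Fin n // (l : ℕ) < k} ≤ k := by
      have := Fintype.card_le_of_injective
        (fun l : {l : Fin n // (l : ℕ) < k} => (⟨l.1, l.2⟩ : Fin k))
        (fun l l' e => by simpa [Subtype.ext_iff, Fin.ext_iff] using e)
      simpa using this
    have h3 : Fintype.card {l : Fin n // n - h ≤ (l : ℕ)} ≤ h := by
      have := Fintype.card_le_of_injective
        (fun l : {l : Fin n // n - h ≤ (l : ℕ)} => (⟨n - 1 - l.1, by omega⟩ : Fin h))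
        (fun l l' e => by
          simp only [Fin.mk.injEq] at e
          ext
          omega)
      simpa using this
    rw [Fintype.card_sum, hfr, ← hU] at h1
    omega
  have hsum := sum_norm_sq_orthogonalProjectionOnto b U
  have hn0 : (0 : ℝ) < n := by exact_mod_cast (by omega : 0 < n)
  have hdr : (i : ℝ) / 2 ≤ Module.finrank ℂ U := by
    have : (i : ℝ) ≤ 2 * Module.finrank ℂ U := by exact_mod_cast (by omega)
    linarith
  have hd1 : (0 : ℝ) < Module.finrank ℂ U := by exact_mod_cast (by omega)
  -- The squared projections of the n basis vectors sum to dim U, so one is at least the average.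
  obtain ⟨j, -, hj⟩ : ∃ j ∈ Finset.univ, (Module.finrank ℂ U : ℝ) / n ≤
      ‖U.orthogonalProjectionOnto (b j)‖ ^ 2 := by
    refine Finset.exists_le_of_sum_le ⟨⟨0, by omega⟩, Finset.mem_univ _⟩ ?_
    rw [hsum, Finset.sum_const, Finset.card_univ, Fintype.card_fin, nsmul_eq_mul]
    exact le_of_eq (by field_simp)
  set x : EuclideanSpace ℂ (Fin n) :=
    ((U.orthogonalProjectionOnto (b j) : U) : EuclideanSpace ℂ (Fin n)) with hx
  have hxU : x ∈ U := Subtype.coe_prop _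
  rw [← Submodule.norm_coe, ← hx] at hj
  have hxpos : 0 < ‖x‖ := by
    have : 0 < ‖x‖ ^ 2 := lt_of_lt_of_le (by positivity) hj
    exact norm_pos_iff.2 fun h0 => by simp [h0] at this
  have hxj : x j = ((‖x‖ ^ 2 : ℝ) : ℂ) := by
    have h2 : inner ℂ x x = inner ℂ (b j) x :=
      Submodule.inner_orthogonalProjectionOnto_eq_of_mem_right (⟨x, hxU⟩ : U) (b j)
    rw [← hbl, ← h2, inner_self_eq_norm_sq_to_K]
    norm_cast
  have hxj0 : x j ≠ 0 := by
    rw [hxj, Complex.ofReal_ne_zero]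
    positivity
  have hxl : ∀ l : Fin n, n - h ≤ (l : ℕ) → x l = 0 := by
    intro l hl
    rw [← hbl]
    exact hmem x hxU (Sum.inr ⟨l, hl⟩)
  have hTx : ‖T x‖ ≤ T.singularValues k * ‖x‖ :=
    norm_apply_le_singularValues_mul T hfr fun l hl => hmem x hxU (Sum.inl ⟨l, hl⟩)
  refine ⟨j, -∑ l ∈ Finset.univ.erase j, (x l / x j) • euclideanCol A l, ?_, ?_⟩
  · refine Submodule.neg_mem _ (Submodule.sum_mem _ fun l hl => ?_)
    by_cases hlm : (l : ℕ) < n - h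
    · exact Submodule.smul_mem _ _
        (Submodule.subset_span ⟨l, ⟨hlm, Finset.ne_of_mem_erase hl⟩, rfl⟩)
    · rw [hxl l (not_lt.1 hlm)]
      simp
  · have h1 : T x = x j • (euclideanCol A j -
        -∑ l ∈ Finset.univ.erase j, (x l / x j) • euclideanCol A l) := by
      rw [hT, toEuclideanLin_eq_sum_col, sub_neg_eq_add, smul_add, Finset.smul_sum,
        ← Finset.add_sum_erase _ _ (Finset.mem_univ j)]
      congr 1
      refine Finset.sum_congr rfl fun l _ => ?_
      rw [smul_smul, mul_div_cancel₀ _ hxj0]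
    have hnj : ‖x j‖ = ‖x‖ ^ 2 := by
      rw [hxj, Complex.norm_real, Real.norm_of_nonneg (by positivity)]
    rw [h1, norm_smul, hnj] at hTx
    have h2 : √((i : ℝ) / 2 / n) ≤ ‖x‖ := by
      refine Real.sqrt_le_iff.2 ⟨hxpos.le, le_trans ?_ hj⟩
      gcongr
    refine (mul_le_mul_of_nonneg_right h2 (norm_nonneg _)).trans ?_
    have h3 : singularValue A (n - i) = T.singularValues k := rfl
    rw [h3]
    refine le_of_mul_le_mul_right ?_ hxpos
    linarith

end LinearAlgebra

/-- The columns other than `j` among those with index less than `n - (i + 1) / 2`. -/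
def otherCols (n i : ℕ) (j : Fin n) : Finset (Fin n) :=
  Finset.univ.filter fun l => (l : ℕ) < n - (i + 1) / 2 ∧ l ≠ j

/-- The outcomes for which the `j`-th column of the shifted corner matrix is close to the span of
the columns in `otherCols n i j`. -/
def closeColumn {Ω : Type*} (X : ℕ → ℕ → Ω → ℂ) {n : ℕ} (v : Fin n → EuclideanSpace ℂ (Fin n)) (i : ℕ)
    (j : Fin n) : Set Ω :=
  {ω | ∃ y ∈ Submodule.span ℂ (Set.range fun l : otherCols n i j =>
      WithLp.toLp 2 (fun a : Fin n => X a l ω) + v l),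
    ‖WithLp.toLp 2 (fun a : Fin n => X a j ω) + v j - y‖ ^ 2 < (i : ℝ) / 2 / 40}

/-! ### Independence of columns, union bound and Borel–Cantelli. -/

section Probability

variable {Ω : Type*} [MeasurableSpace Ω] {P : Measure Ω} {X : ℕ → ℕ → Ω → ℂ}

theorem IsIIDTable.map_col_eq_pi (hX : IsIIDTable X P) {n : ℕ} (j : Fin n) :
    P.map (fun ω (a : Fin n) => X a j ω) = Measure.pi fun _ => P.map (X 0 0) := by
  have h1 : iIndepFun (fun a : Fin n => X a j) P :=
    hX.indep.precomp (g := fun a : Fin n => ((a : ℕ), (j : ℕ)))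
      fun a a' h => Fin.ext (Prod.ext_iff.1 h).1
  rw [h1.map_fun_eq_pi_map fun a : Fin n => (hX.measurable a j).aemeasurable]
  congr 1
  funext a
  exact (hX.ident a j).map_eq

theorem IsIIDTable.indepFun_col (hX : IsIIDTable X P) {n : ℕ} {j : Fin n} {S : Finset (Fin n)}
    (hj : j ∉ S) :
    IndepFun (fun ω (a : Fin n) => X a j ω) (fun ω (l : S) (a : Fin n) => X a l ω) P := by
  have h1 : iIndepFun (fun p : Fin n × Fin n => X p.1 p.2) P :=
    hX.indep.precomp (g := fun p : Fin n × Fin n => ((p.1 : ℕ), (p.2 : ℕ)))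
      fun p p' h => Prod.ext (Fin.ext (Prod.ext_iff.1 h).1) (Fin.ext (Prod.ext_iff.1 h).2)
  have h2 := h1.indepFun_finset (Finset.univ ×ˢ {j}) (Finset.univ ×ˢ S)
    (Finset.disjoint_product.2 (Or.inr (by simpa using hj))) fun p => hX.measurable p.1 p.2
  exact h2.comp
    (φ := fun z (a : Fin n) => z ⟨(a, j), by simp⟩)
    (ψ := fun z (l : S) (a : Fin n) => z ⟨(a, l), by simp⟩)
    (measurable_pi_lambda _ fun a => measurable_pi_apply _)
    (measurable_pi_lambda _ fun l => measurable_pi_lambda _ fun a => measurable_pi_apply _)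

variable [IsProbabilityMeasure P]

/-- Columns of the shifted corner matrix are far from the span of the other ones. -/
theorem IsIIDTable.eventually_measure_col_le (hX : IsIIDTable X P) :
    ∀ᶠ n : ℕ in atTop, ∀ (v : Fin n → EuclideanSpace ℂ (Fin n)) (j : Fin n) (S : Finset (Fin n))
      (K : ℝ), j ∉ S → √n / 2 ≤ K → K + S.card ≤ n →
      P {ω | ∃ y ∈ Submodule.span ℂ
          (Set.range fun l : S => WithLp.toLp 2 (fun a : Fin n => X a l ω) + v l),
        ‖WithLp.toLp 2 (fun a : Fin n => X a j ω) + v j - y‖ ^ 2 < K / 40} ≤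
      ENNReal.ofReal (1 / (n : ℝ) ^ 4) := by
  set μ := P.map (X 0 0) with hμ
  have hm : AEMeasurable (X 0 0) P := (hX.measurable 0 0).aemeasurable
  have : IsProbabilityMeasure μ := Measure.isProbabilityMeasure_map hm
  have h2 : MemLp id 2 μ := (memLp_map_measure_iff (by fun_prop) hm).2 hX.sq_integrable
  have hvar : (∫ x, ‖x‖ ^ 2 ∂μ) - ‖∫ x, x ∂μ‖ ^ 2 = 1 := by
    rw [hμ, integral_map hm (by fun_prop), integral_map hm (by fun_prop)]
    exact hX.variance_one
  filter_upwards [eventually_measureReal_exists_mem_submodule_le μ h2 hvar] with n hn v j S K hj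
    hK hKS
  let E : Set ((Fin n → ℂ) × (S → Fin n → ℂ)) := {z | ∃ y ∈ Submodule.span ℂ
    (Set.range fun l : S => WithLp.toLp 2 (z.2 l) + v l),
      ‖WithLp.toLp 2 z.1 + v j - y‖ ^ 2 < K / 40}
  -- The strict inequality makes E open: it is a union, over the coefficients, of open sets.
  have hE : MeasurableSet E := by
    have : E = ⋃ c : S → ℂ, {z | ‖WithLp.toLp 2 z.1 + v j -
        ∑ l, c l • (WithLp.toLp 2 (z.2 l) + v l)‖ ^ 2 < K / 40} := by
      ext z
      simp only [E, Set.mem_ofPred_eq, Set.mem_iUnion, Submodule.mem_span_range_iff_exists_fun]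
      constructor
      · rintro ⟨y, ⟨c, rfl⟩, h⟩
        exact ⟨c, h⟩
      · rintro ⟨c, h⟩
        exact ⟨_, ⟨c, rfl⟩, h⟩
    rw [this]
    exact (isOpen_iUnion fun c => isOpen_lt (by fun_prop) continuous_const).measurableSet
  have hmc : Measurable (fun ω (a : Fin n) => X a j ω) :=
    measurable_pi_lambda _ fun a => hX.measurable a j
  have hmS : Measurable (fun ω (l : S) (a : Fin n) => X a l ω) :=
    measurable_pi_lambda _ fun l => measurable_pi_lambda _ fun a => hX.measurable a l
  have hprod := (indepFun_iff_map_prod_eq_prod_map_map hmc.aemeasurable hmS.aemeasurable).1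
    (hX.indepFun_col hj)
  have : IsProbabilityMeasure (P.map fun ω (l : S) (a : Fin n) => X a l ω) :=
    Measure.isProbabilityMeasure_map hmS.aemeasurable
  change P ((fun ω => ((fun a : Fin n => X a j ω), fun (l : S) (a : Fin n) => X a l ω)) ⁻¹' E) ≤ _
  -- By independence the other columns can be frozen; the estimate is uniform in the resulting
  -- subspace.
  rw [← Measure.map_apply (hmc.prodMk hmS) hE, hprod, hX.map_col_eq_pi,
    Measure.prod_apply_symm hE]
  refine (lintegral_mono (g := fun _ => ENNReal.ofReal (1 / (n : ℝ) ^ 4)) fun Y => ?_).trans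
    (by simp)
  refine ENNReal.le_ofReal_iff_toReal_le (measure_ne_top _ _) (by positivity) |>.2 ?_
  refine hn (Submodule.span ℂ (Set.range fun l : S => WithLp.toLp 2 (Y l) + v l)) (v j) K hK ?_
  have h3 := finrank_le_finrank_orthogonal_span_add_card (𝕜 := ℂ)
    (fun l : S => WithLp.toLp 2 (Y l) + v l)
  rw [finrank_euclideanSpace_fin, Fintype.card_coe] at h3
  have h4 : (n : ℝ) ≤ Module.finrank ℂ
    (Submodule.span ℂ (Set.range fun l : S => WithLp.toLp 2 (Y l) + v l))ᗮ + S.card := by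
    exact_mod_cast h3
  linarith

theorem card_otherCols_le (n i : ℕ) (j : Fin n) : (otherCols n i j).card ≤ n - (i + 1) / 2 := by
  have : (otherCols n i j).map Fin.valEmbedding ⊆ Finset.range (n - (i + 1) / 2) := by
    intro l hl
    obtain ⟨l, hl', rfl⟩ := Finset.mem_map.1 hl
    simpa using (Finset.mem_filter.1 hl').2.1
  simpa using Finset.card_le_card this

theorem IsIIDTable.ae_eventually_notMem_closeColumn (hX : IsIIDTable X P)
    (v : (n : ℕ) → Fin n → EuclideanSpace ℂ (Fin n)) :
    ∀ᵐ ω ∂P, ∀ᶠ n : ℕ in atTop, ∀ i : ℕ, √n ≤ i → i < n → ∀ j : Fin n,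
      ω ∉ closeColumn X (v n) i j := by
  obtain ⟨N, hN⟩ := eventually_atTop.1 hX.eventually_measure_col_le
  -- Emptying the event for n < N makes the summable bound hold for every n. At most n² pairs (i,
  -- j), each of probability at most n⁻⁴, give n⁻².
  let B : ℕ → Set Ω := fun n => if N ≤ n then
    ⋃ i ∈ (Finset.range n).filter fun i : ℕ => √n ≤ i, ⋃ j ∈ (Finset.univ : Finset (Fin n)),
      closeColumn X (v n) i j else ∅
  have hB : ∀ n, P (B n) ≤ ENNReal.ofReal (1 / (n : ℝ) ^ 2) := by
    intro n
    by_cases hn : N ≤ n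
    · simp only [B, if_pos hn]
      have hcol : ∀ i ∈ (Finset.range n).filter fun i : ℕ => √n ≤ i, ∀ j : Fin n,
          P (closeColumn X (v n) i j) ≤ ENNReal.ofReal (1 / (n : ℝ) ^ 4) := by
        intro i hi j
        obtain ⟨hin, hi⟩ := Finset.mem_filter.1 hi
        refine hN n hn (v n) j (otherCols n i j) (i / 2) (by simp [otherCols]) (by linarith) ?_
        have h1 := card_otherCols_le n i j
        have h2 : i + 2 * (otherCols n i j).card ≤ 2 * n := by
          have := Finset.mem_range.1 hin
          omega
        have h3 : (i : ℝ) + 2 * (otherCols n i j).card ≤ 2 * n := by exact_mod_cast h2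
        linarith
      calc _ ≤ ∑ i ∈ (Finset.range n).filter fun i : ℕ => √n ≤ i, ∑ j : Fin n,
            ENNReal.ofReal (1 / (n : ℝ) ^ 4) :=
          (measure_biUnion_finset_le _ _).trans (Finset.sum_le_sum fun i hi =>
            (measure_biUnion_finset_le _ _).trans (Finset.sum_le_sum fun j _ => hcol i hi j))
        _ ≤ ∑ i ∈ Finset.range n, ∑ j : Fin n, ENNReal.ofReal (1 / (n : ℝ) ^ 4) :=
          Finset.sum_le_sum_of_subset (Finset.filter_subset _ _)
        _ = ENNReal.ofReal (1 / (n : ℝ) ^ 2) := by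
          simp only [Finset.sum_const, Finset.card_univ, Fintype.card_fin, Finset.card_range,
            nsmul_eq_mul]
          rw [← ENNReal.ofReal_natCast, ← ENNReal.ofReal_mul (by positivity),
            ← ENNReal.ofReal_mul (by positivity)]
          congr 1
          rcases n.eq_zero_or_pos with rfl | hn0
          · simp
          · field_simp
    · simp [B, if_neg hn]
  have hsum : ∑' n, P (B n) ≠ ⊤ := by
    refine ne_top_of_le_ne_top ?_ (ENNReal.tsum_le_tsum hB)
    exact (Real.summable_one_div_nat_pow.2 one_lt_two).tsum_ofReal_ne_top
  filter_upwards [ae_eventually_notMem hsum] with ω hω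
  filter_upwards [hω, eventually_ge_atTop N] with n hn hNn i hi hin j hmem
  refine hn ?_
  simp only [B, if_pos hNn, Set.mem_iUnion]
  exact ⟨i, Finset.mem_filter.2 ⟨Finset.mem_range.2 hin, hi⟩, j, Finset.mem_univ _, hmem⟩

end Probability

/-! ### Assembly. -/

theorem le_singularValue_of_notMem_closeColumn {Ω : Type*} {X : ℕ → ℕ → Ω → ℂ} {n i : ℕ} (hi : i < n)
    (M : Matrix (Fin n) (Fin n) ℂ) {ω : Ω}
    (h : ∀ j, ω ∉ closeColumn X (fun l => ((√n : ℝ) : ℂ) • euclideanCol M l) i j) :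
    1 / 20 * ((i : ℝ) / n) ≤
      singularValue (((Real.sqrt n)⁻¹ : ℂ) • cornerMatrix X n ω + M) (n - i) := by
  set A := ((Real.sqrt n)⁻¹ : ℂ) • cornerMatrix X n ω + M with hA
  have hn0 : (0 : ℝ) < n := by exact_mod_cast (by omega : 0 < n)
  have hs : (0 : ℝ) < √n := Real.sqrt_pos.2 hn0
  have hsC : ((√n : ℝ) : ℂ) ≠ 0 := by exact_mod_cast hs.ne'
  obtain ⟨j, y, hy, hle⟩ := exists_sqrt_mul_norm_col_sub_le_singularValue A hi
  -- Scaling by √n turns the columns into unnormalised random columns with a deterministic shift;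
  -- distances scale by √n.
  have hcol : ∀ l : Fin n,
      WithLp.toLp 2 (fun a : Fin n => X a l ω) + ((√n : ℝ) : ℂ) • euclideanCol M l =
      ((√n : ℝ) : ℂ) • euclideanCol A l := by
    intro l
    ext a
    simp only [euclideanCol, hA, cornerMatrix, PiLp.add_apply, PiLp.smul_apply, Matrix.add_apply,
      Matrix.smul_apply, Matrix.of_apply, smul_eq_mul]
    field_simp
  have hj := h j
  simp only [closeColumn, Set.mem_ofPred_eq, hcol, not_exists, not_and, not_lt] at hj
  have hy' : ((√n : ℝ) : ℂ) • y ∈ Submodule.span ℂ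
      (Set.range fun l : otherCols n i j => ((√n : ℝ) : ℂ) • euclideanCol A l) := by
    refine Submodule.span_induction (p := fun y _ => ((√n : ℝ) : ℂ) • y ∈ Submodule.span ℂ
      (Set.range fun l : otherCols n i j => ((√n : ℝ) : ℂ) • euclideanCol A l)) ?_ ?_ ?_ ?_ hy
    · rintro _ ⟨l, hl, rfl⟩
      exact Submodule.subset_span ⟨⟨l, Finset.mem_filter.2 ⟨Finset.mem_univ _, hl⟩⟩, rfl⟩
    · simp
    · intro x z _ _ hx hz
      rw [smul_add]
      exact Submodule.add_mem _ hx hz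
    · intro c x _ hx
      rw [smul_comm]
      exact Submodule.smul_mem _ c hx
  have h1 := hj _ hy'
  rw [← smul_sub, norm_smul, Complex.norm_real, Real.norm_of_nonneg hs.le, mul_pow,
    Real.sq_sqrt hn0.le] at h1
  refine le_trans ?_ hle
  refine le_of_sq_le_sq ?_ (by positivity)
  have h2 : (i : ℝ) / 2 / 40 / n ≤ ‖euclideanCol A j - y‖ ^ 2 := by
    rw [div_le_iff₀ hn0]
    linarith
  rw [mul_pow √_, Real.sq_sqrt (by positivity)]
  -- The squared bound is (i/n)²/160, and 1/20² < 1/160.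
  calc _ ≤ (i : ℝ) / 2 / n * ((i : ℝ) / 2 / 40 / n) := by
        have : 0 ≤ ((i : ℝ) / n) ^ 2 := by positivity
        have e : (i : ℝ) / 2 / n * ((i : ℝ) / 2 / 40 / n) = 1 / 160 * ((i : ℝ) / n) ^ 2 := by ring
        rw [e, mul_pow]
        nlinarith
    _ ≤ _ := mul_le_mul_of_nonneg_left h2 (by positivity)

theorem mainTheorem7 :
    ∃ c₀ : ℝ, 0 < c₀ ∧ ∃ γ : ℝ, 0 < γ ∧ γ < 1 ∧
      ∀ (Ω : Type*) [MeasurableSpace Ω] (P : Measure Ω) [IsProbabilityMeasure P]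
        (X : ℕ → ℕ → Ω → ℂ), IsIIDTable X P →
        ∀ M : (n : ℕ) → Matrix (Fin n) (Fin n) ℂ,
          ∀ᵐ ω ∂P, ∀ᶠ n : ℕ in atTop, ∀ i : ℕ, (n : ℝ) ^ (1 - γ) ≤ (i : ℝ) → i ≤ n - 1 →
            c₀ * ((i : ℝ) / (n : ℝ)) ≤
              singularValue (((Real.sqrt n)⁻¹ : ℂ) • cornerMatrix X n ω + M n) (n - i) := by
  -- With γ = 1/2 the range of i starts at √n, which yields the codimension √n/2 needed by the
  -- distance estimate.
  refine ⟨1 / 20, by norm_num, 1 / 2, by norm_num, by norm_num, ?_⟩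
  intro Ω _ P _ X hX M
  filter_upwards [hX.ae_eventually_notMem_closeColumn
    fun n l => ((√n : ℝ) : ℂ) • euclideanCol (M n) l] with ω hω
  filter_upwards [hω, eventually_ge_atTop 1] with n hn hn1 i hi hin
  have hlt : i < n := by omega
  refine le_singularValue_of_notMem_closeColumn hlt (M n) (hn i ?_ hlt)
  rw [Real.sqrt_eq_rpow]
  norm_num at hi ⊢
  exact hi
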